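/- Let $1\le r<n$ and let $A,E\in\mathbf{R}^{n\times n}$ be symmetric. Let $\lambda_1\ge\dots\ge\lambda_n$ be the eigenvalues of $A$, assume $\lambda_r>\lambda_{r+1}$, and let $$A=V_1\Lambda_1V_1^T+V_2\Lambda_2V_2^T,\qquad \Lambda_1=\mathrm{diag}(\lambda_1,\dots,\lambda_r),\quad \Lambda_2=\mathrm{diag}(\lambda_{r+1},\dots,\lambda_n),$$ be an eigen-decomposition, where the columns of $V_1\in\mathbf{R}^{n\times r}$ and $V_2\in\mathbf{R}^{n\times(n-r)}$ together form an orthonormal basis of $\mathbf{R}^n$. Write $E_{i,j}=V_i^TEV_j$ for $i,j\in\{1,2\}$. Let $\|\cdot\|_2$ be the spectral norm and $\|B\|_{2,\infty}=\max_i\|B_{i,:}\|_2$ the largest Euclidean norm of a row of $B$. Put $$\mathrm{sep}_2(\Lambda_1,\Lambda_2)=\inf\{\|Z\Lambda_1-\Lambda_2Z\|_2 : Z\in\mathbf{R}^{(n-r)\times r},\ \|Z\|_2=1\},$$ $$\mathrm{sep}_{(2,\infty),V_2}(\Lambda_1,V_2\Lambda_2V_2^T)=\inf\{\|Z\Lambda_1-V_2\Lambda_2V_2^TZ\|_{2,\infty}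 : Z\in\mathbf{R}^{n\times r},\ \mathrm{ran}\,Z\subseteq\mathrm{ran}\,V_2,\ \|Z\|_{2,\infty}=1\},$$ $$\mathrm{gap}=\min\{\mathrm{sep}_2(\Lambda_1,\Lambda_2),\ \mathrm{sep}_{(2,\infty),V_2}(\Lambda_1,V_2\Lambda_2V_2^T)\}.$$ Suppose that $\|E\|_2\le \mathrm{gap}/5$. Let $\widehat V_1\in\mathbf{R}^{n\times r}$ be any matrix with orthonormal columns whose range is the dominant $r$-dimensional invariant subspace of $A+E$, that is, the span of eigenvectors belonging to its $r$ algebraically largest eigenvalues, counted with multiplicity. Then $$\min\{\|\widehat V_1U-V_1\|_{2,\infty} : U\in\mathbf{R}^{r\times r}\text{ orthogonal}\}\ \le\ 8\|V_1\|_{2,\infty}\left(\frac{\|E_{2,1}\|_2}{\mathrm{sep}_2(\Lambda_1,\Lambda_2)}\right)^2+2\,\frac{\|V_2E_{2,1}\|_{2,\infty}}{\mathrm{gap}}+4\,\frac{\|V_2E_{2,2}V_2^T\|_{2,\infty}\,\|E_{2,1}\|_2}{\mathrm{gap}\cdot\mathrm{sep}_2(\Lambda_1,\Lambda_2)}.$$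 -/

import Mathlib

open scoped Matrix

noncomputable section

namespace RowPerturb

open scoped Matrix.Norms.L2Operator in
/-- The spectral norm `‖B‖₂` of a rectangular real matrix: the operator norm induced by the
Euclidean vector norms. -/
def norm2 {p q : ℕ} (B : Matrix (Fin p) (Fin q) ℝ) : ℝ :=
  ‖B‖

/-- The two-to-infinity norm `‖B‖_{2,∞}`: the maximum of the Euclidean norms of the rows of `B`. -/
def norm2Inf {p q : ℕ} (B : Matrix (Fin p) (Fin q) ℝ) : ℝ :=
  ⨆ i : Fin p, ‖(WithLp.toLp 2 (B i) : EuclideanSpace ℝ (Fin q))‖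

/-- `sep_ν(B, C) = inf {ν(ZB - CZ) : ν(Z) = 1}`, for a norm `ν` on `m × ℓ` matrices. -/
def sep {l m : ℕ} (ν : Matrix (Fin m) (Fin l) ℝ → ℝ)
    (B : Matrix (Fin l) (Fin l) ℝ) (C : Matrix (Fin m) (Fin m) ℝ) : ℝ :=
  sInf {x : ℝ | ∃ Z : Matrix (Fin m) (Fin l) ℝ, ν Z = 1 ∧ x = ν (Z * B - C * Z)}

/-- The restricted separation `sep_{ν,W}(B, C)`: the infimum defining `sep_ν(B, C)` is taken only
over the matrices `Z` all of whose columns lie in the range of `W`. -/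
def sepOn {l m k : ℕ} (ν : Matrix (Fin m) (Fin l) ℝ → ℝ) (W : Matrix (Fin m) (Fin k) ℝ)
    (B : Matrix (Fin l) (Fin l) ℝ) (C : Matrix (Fin m) (Fin m) ℝ) : ℝ :=
  sInf {x : ℝ | ∃ Z : Matrix (Fin m) (Fin l) ℝ,
    (∀ j, Z.col j ∈ LinearMap.range W.mulVecLin) ∧ ν Z = 1 ∧ x = ν (Z * B - C * Z)}

/-- `Λ₁ = diag(λ₁, …, λ_r)`. -/
def topDiag {n r : ℕ} (hrn : r ≤ n) (lam : Fin n → ℝ) : Matrix (Fin r) (Fin r) ℝ :=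
  Matrix.diagonal fun i => lam ⟨i, i.isLt.trans_le hrn⟩

/-- `Λ₂ = diag(λ_{r+1}, …, λ_n)`. -/
def botDiag {n r : ℕ} (hrn : r ≤ n) (lam : Fin n → ℝ) : Matrix (Fin (n - r)) (Fin (n - r)) ℝ :=
  Matrix.diagonal fun j => lam ⟨r + j, by omega⟩

/-- `A = V₁ Λ₁ V₁ᵀ + V₂ Λ₂ V₂ᵀ` is an eigen-decomposition of the symmetric matrix `A`: the
eigenvalues `lam` are in descending order and the columns of `[V₁ | V₂]` are orthonormal.
No gap between the two groups of eigenvalues is included here. -/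
structure IsEigenDecomp {n r : ℕ} (hrn : r ≤ n) (A : Matrix (Fin n) (Fin n) ℝ) (lam : Fin n → ℝ)
    (V₁ : Matrix (Fin n) (Fin r) ℝ) (V₂ : Matrix (Fin n) (Fin (n - r)) ℝ) : Prop where
  antitone : Antitone lam
  orthonormal₁ : V₁ᵀ * V₁ = 1
  orthonormal₂ : V₂ᵀ * V₂ = 1
  orthogonal : V₁ᵀ * V₂ = 0
  decomp : A = V₁ * topDiag hrn lam * V₁ᵀ + V₂ * botDiag hrn lam * V₂ᵀ

/-- `S` is a dominant `r`-dimensional invariant subspace of the symmetric matrix `M`: the span of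
orthonormal eigenvectors belonging to the `r` algebraically largest eigenvalues (counted with
multiplicity). It is unique as soon as the `r`-th eigenvalue exceeds the next one. -/
def IsDominantSubspace {n r : ℕ} (hrn : r ≤ n) (M : Matrix (Fin n) (Fin n) ℝ)
    (S : Submodule ℝ (Fin n → ℝ)) : Prop :=
  ∃ (mu : Fin n → ℝ) (W₁ : Matrix (Fin n) (Fin r) ℝ) (W₂ : Matrix (Fin n) (Fin (n - r)) ℝ),
    IsEigenDecomp hrn M mu W₁ W₂ ∧ S = LinearMap.range W₁.mulVecLin

/-- `gap = min {sep₂(Λ₁, Λ₂), sep_{(2,∞),V₂}(Λ₁, V₂ Λ₂ V₂ᵀ)}`. -/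
def gap {n r : ℕ} (hrn : r ≤ n) (lam : Fin n → ℝ) (V₂ : Matrix (Fin n) (Fin (n - r)) ℝ) : ℝ :=
  min (sep norm2 (topDiag hrn lam) (botDiag hrn lam))
    (sepOn norm2Inf V₂ (topDiag hrn lam) (V₂ * botDiag hrn lam * V₂ᵀ))

end RowPerturb

end

/-! Let `W₁` be an orthonormal dominant basis of `A + E`, `P = V₁ᵀ W₁` (cosines), `V₂ᵀ W₁` (sines)
and `X = V₂ᵀ W₁ P⁻¹` (tangents), so `W₁ = (V₁ + V₂ X) P`. Let `δ` be the eigenvalue gap, equal to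
`sep₂`. The sin Θ bound makes `P` invertible with `‖X‖ ≤ 1/2` (`isUnit_cos`, `norm_tan_le_half`).
Invariance of the range of `V₁ + V₂ X` is a Riccati equation for `X`; since `E` is small, its terms
in `X` are absorbed on the left, which gives `‖X‖ ≤ 2‖E₂₁‖/δ` in the spectral norm and, with the
restricted separation, a bound on the rows of `V₂ X`.

For the alignment, choose the orthogonal `U` for which `P U = H` is the positive polar factor. Then
`W₁ U - V₁ = V₁ (H - 1) + V₂ X H`, where `‖H‖ ≤ 1` and `‖H - 1‖ ≤ ‖1 - P Pᵀ‖ ≤ ‖X‖²`. The first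
summand is therefore quadratic in `E₂₁`, and the row bound on `V₂ X` controls the second. -/

namespace RowPerturb

open scoped Matrix.Norms.L2Operator
open Matrix

/-! ### Spectral norm: Sylvester lower bound and polar factor. -/

section SpectralNorm

variable {m n k : ℕ}

lemma dotProduct_self_eq_norm_sq (v : Fin n → ℝ) :
    v ⬝ᵥ v = ‖(WithLp.toLp 2 v : EuclideanSpace ℝ (Fin n))‖ ^ 2 := by
  rw [EuclideanSpace.norm_sq_eq]
  simp [dotProduct, sq]

lemma dotProduct_self_nonneg' (v : Fin n → ℝ) : 0 ≤ v ⬝ᵥ v := by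
  rw [dotProduct_self_eq_norm_sq]; positivity

lemma norm_toLp_mulVec_le (B : Matrix (Fin m) (Fin n) ℝ) (v : Fin n → ℝ) :
    ‖(WithLp.toLp 2 (B *ᵥ v) : EuclideanSpace ℝ (Fin m))‖ ≤
      ‖B‖ * ‖(WithLp.toLp 2 v : EuclideanSpace ℝ (Fin n))‖ :=
  l2_opNorm_mulVec B (WithLp.toLp 2 v)

lemma dotProduct_mulVec_self_le (B : Matrix (Fin m) (Fin n) ℝ) (v : Fin n → ℝ) :
    (B *ᵥ v) ⬝ᵥ (B *ᵥ v) ≤ ‖B‖ ^ 2 * (v ⬝ᵥ v) := by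
  rw [dotProduct_self_eq_norm_sq, dotProduct_self_eq_norm_sq, ← mul_pow]
  gcongr
  exact norm_toLp_mulVec_le B v

lemma l2_opNorm_le_of_dotProduct_le {B : Matrix (Fin m) (Fin n) ℝ} {c : ℝ} (hc : 0 ≤ c)
    (h : ∀ v, (B *ᵥ v) ⬝ᵥ (B *ᵥ v) ≤ c ^ 2 * (v ⬝ᵥ v)) : ‖B‖ ≤ c := by
  rw [l2_opNorm_def]
  refine ContinuousLinearMap.opNorm_le_bound _ hc fun x => ?_
  have := h (WithLp.ofLp x)
  rw [dotProduct_self_eq_norm_sq, dotProduct_self_eq_norm_sq, ← mul_pow] at this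
  exact (sq_le_sq₀ (norm_nonneg _) (by positivity)).1 this

lemma l2_opNorm_transpose (B : Matrix (Fin m) (Fin n) ℝ) : ‖Bᵀ‖ = ‖B‖ := by
  rw [← conjTranspose_eq_transpose_of_trivial, l2_opNorm_conjTranspose]

lemma mulVec_dotProduct_mulVec (B : Matrix (Fin m) (Fin n) ℝ) (C : Matrix (Fin m) (Fin k) ℝ)
    (v : Fin n → ℝ) (w : Fin k → ℝ) :
    (B *ᵥ v) ⬝ᵥ (C *ᵥ w) = v ⬝ᵥ ((Bᵀ * C) *ᵥ w) := by
  rw [dotProduct_mulVec, dotProduct_mulVec, ← vecMul_vecMul, vecMul_transpose]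

lemma l2_opNorm_le_one_of_orthonormal {V : Matrix (Fin m) (Fin n) ℝ} (hV : Vᵀ * V = 1) :
    ‖V‖ ≤ 1 :=
  l2_opNorm_le_of_dotProduct_le zero_le_one fun v => by
    simp [mulVec_dotProduct_mulVec, hV]

lemma l2_opNorm_compress_le {U : Matrix (Fin n) (Fin m) ℝ} {V : Matrix (Fin n) (Fin k) ℝ}
    (hU : Uᵀ * U = 1) (hV : Vᵀ * V = 1) (E : Matrix (Fin n) (Fin n) ℝ) :
    ‖Uᵀ * E * V‖ ≤ ‖E‖ := by
  have h1 := l2_opNorm_le_one_of_orthonormal hU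
  have h2 := l2_opNorm_le_one_of_orthonormal hV
  calc ‖Uᵀ * E * V‖ ≤ ‖Uᵀ‖ * ‖E‖ * ‖V‖ :=
        (l2_opNorm_mul _ _).trans (by gcongr; exact l2_opNorm_mul _ _)
    _ ≤ 1 * ‖E‖ * 1 := by rw [l2_opNorm_transpose]; gcongr
    _ = ‖E‖ := by ring

lemma isUnit_det_of_dotProduct_le {M : Matrix (Fin n) (Fin n) ℝ} {κ : ℝ} (hκ : 0 < κ)
    (h : ∀ v, κ * (v ⬝ᵥ v) ≤ (M *ᵥ v) ⬝ᵥ (M *ᵥ v)) : IsUnit M.det := by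
  rw [← isUnit_iff_isUnit_det, ← mulVec_injective_iff_isUnit]
  intro v w hvw
  have h0 : M *ᵥ (v - w) = 0 := by rw [mulVec_sub]; exact sub_eq_zero.2 hvw
  have h1 := h (v - w)
  rw [h0, dotProduct_zero] at h1
  have h2 : (v - w) ⬝ᵥ (v - w) = 0 :=
    le_antisymm (by nlinarith [dotProduct_self_nonneg' (v - w)]) (dotProduct_self_nonneg' _)
  exact sub_eq_zero.1 (dotProduct_self_eq_zero.1 h2)

lemma l2_opNorm_inv_sq_le {M : Matrix (Fin n) (Fin n) ℝ} {κ : ℝ} (hκ : 0 < κ)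
    (h : ∀ v, κ * (v ⬝ᵥ v) ≤ (M *ᵥ v) ⬝ᵥ (M *ᵥ v)) : ‖M⁻¹‖ ^ 2 ≤ κ⁻¹ := by
  have hu := isUnit_det_of_dotProduct_le hκ h
  have : ‖M⁻¹‖ ≤ √κ⁻¹ := by
    refine l2_opNorm_le_of_dotProduct_le (Real.sqrt_nonneg _) fun v => ?_
    rw [Real.sq_sqrt (by positivity)]
    have := h (M⁻¹ *ᵥ v)
    rw [mulVec_mulVec, mul_nonsing_inv _ hu, one_mulVec] at this
    rwa [inv_mul_eq_div, le_div_iff₀ hκ, mul_comm]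
  calc ‖M⁻¹‖ ^ 2 ≤ √κ⁻¹ ^ 2 := by gcongr
    _ = κ⁻¹ := Real.sq_sqrt (by positivity)

/-- The Sylvester operator of two diagonal matrices whose spectra are separated by the interval
`[β, α]` is bounded below by `α - β` in the spectral norm. -/
lemma sub_mul_l2_opNorm_le_sylvester {a : Fin n → ℝ} {b : Fin m → ℝ} {α β : ℝ} (hβα : β < α)
    (ha : ∀ i, α ≤ a i) (hb : ∀ j, b j ≤ β) (Z : Matrix (Fin m) (Fin n) ℝ) :
    (α - β) * ‖Z‖ ≤ ‖Z * diagonal a - diagonal b * Z‖ := by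
  -- Shifting both diagonals by `c` leaves the Sylvester operator unchanged. With `c` this far left,
  -- `|b j - c| ≤ β - c` even for very negative `b j`; `c ≤ β` is stated separately because `m` may
  -- be `0`.
  obtain ⟨c, hcβ, hc⟩ : ∃ c ≤ β, ∀ j, c ≤ (b j + β) / 2 := by
    obtain ⟨c, hc⟩ := (Set.finite_range fun j => (b j + β) / 2).bddBelow
    exact ⟨min c β, min_le_right _ _, fun j => (min_le_left _ _).trans (hc ⟨j, rfl⟩)⟩
  have hαc : 0 < α - c := by linarith
  have hne : ∀ i, a i - c ≠ 0 := fun i => by have := ha i; linarith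
  have h1 : (α - c) * ‖Z‖ ≤ ‖Z * diagonal fun i => a i - c‖ := by
    have hZ : Z = (Z * diagonal fun i => a i - c) * diagonal fun i => (a i - c)⁻¹ := by
      rw [Matrix.mul_assoc, diagonal_mul_diagonal]
      simp [hne]
    have hd : ‖(diagonal fun i => (a i - c)⁻¹ : Matrix (Fin n) (Fin n) ℝ)‖ ≤ (α - c)⁻¹ := by
      rw [l2_opNorm_diagonal, pi_norm_le_iff_of_nonneg (by positivity)]
      intro i
      have := ha i
      rw [norm_inv, Real.norm_of_nonneg (by linarith)]
      gcongr
    have : ‖Z‖ ≤ ‖Z * diagonal fun i => a i - c‖ * (α - c)⁻¹ := by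
      conv_lhs => rw [hZ]
      exact (l2_opNorm_mul _ _).trans (by gcongr)
    rwa [← div_eq_mul_inv, le_div_iff₀ hαc, mul_comm] at this
  have h2 : ‖(diagonal fun j => b j - c) * Z‖ ≤ (β - c) * ‖Z‖ := by
    refine (l2_opNorm_mul _ _).trans ?_
    gcongr
    rw [l2_opNorm_diagonal, pi_norm_le_iff_of_nonneg (by linarith)]
    intro j
    have := hc j
    have := hb j
    rw [Real.norm_eq_abs, abs_le]
    constructor <;> linarith
  have h3 : Z * diagonal a - diagonal b * Z =
      (Z * diagonal fun i => a i - c) - (diagonal fun j => b j - c) * Z := by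
    ext i j
    simp only [Matrix.sub_apply, mul_diagonal, diagonal_mul]
    ring
  rw [h3]
  have := norm_sub_norm_le (Z * diagonal fun i => a i - c) ((diagonal fun j => b j - c) * Z)
  linarith

open scoped MatrixOrder in
/-- Polar decomposition of an invertible contraction, with the distance of its positive factor
from the identity. -/
lemma exists_polar {P : Matrix (Fin n) (Fin n) ℝ} (hP : IsUnit P.det) (hP1 : ‖P‖ ≤ 1) :
    ∃ U ∈ orthogonalGroup (Fin n) ℝ, ‖P * U‖ ≤ 1 ∧ ‖P * U - 1‖ ≤ ‖1 - P * Pᵀ‖ := by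
  have hps : (P * Pᵀ).PosSemidef := by
    rw [← conjTranspose_eq_transpose_of_trivial]
    exact posSemidef_self_mul_conjTranspose P
  set H := CFC.sqrt (P * Pᵀ) with hH
  have hHps : H.PosSemidef := (CFC.sqrt_nonneg (P * Pᵀ)).posSemidef
  have hHH : H * H = P * Pᵀ := CFC.sqrt_mul_sqrt_self _ hps.nonneg
  have hHt : Hᵀ = H := by
    rw [← conjTranspose_eq_transpose_of_trivial]; exact hHps.1
  have hPH : P * (P⁻¹ * H) = H := by
    rw [← Matrix.mul_assoc, mul_nonsing_inv _ hP, Matrix.one_mul]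
  refine ⟨P⁻¹ * H, ?_, ?_, ?_⟩
  · rw [mem_orthogonalGroup_iff, transpose_mul, hHt, Matrix.mul_assoc, ← Matrix.mul_assoc H, hHH, transpose_nonsing_inv,
      ← Matrix.mul_assoc, ← Matrix.mul_assoc, nonsing_inv_mul _ hP, Matrix.one_mul,
      mul_nonsing_inv _ (by rwa [det_transpose])]
  · rw [hPH]
    have h1 : ‖H‖ * ‖H‖ ≤ 1 := by
      rw [← l2_opNorm_conjTranspose_mul_self, conjTranspose_eq_transpose_of_trivial, hHt, hHH]
      refine (l2_opNorm_mul _ _).trans ?_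
      rw [l2_opNorm_transpose]
      nlinarith [norm_nonneg P]
    nlinarith [norm_nonneg H]
  · rw [hPH]
    refine l2_opNorm_le_of_dotProduct_le (norm_nonneg _) fun v => ?_
    refine le_trans ?_ (dotProduct_mulVec_self_le _ v)
    rw [← hHH]
    set w := (H - 1) *ᵥ v with hw
    -- Since `H ≥ 0`, the factor `1 + H` of `1 - H²` does not shrink `w`.
    have h1 : (1 - H * H) *ᵥ v = -(w + H *ᵥ w) := by
      rw [hw, mulVec_mulVec, ← add_mulVec, ← neg_mulVec]
      congr 1
      noncomm_ring
    have h2 : 0 ≤ w ⬝ᵥ (H *ᵥ w) := by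
      simpa using hHps.dotProduct_mulVec_nonneg w
    have h3 := dotProduct_self_nonneg' (H *ᵥ w)
    rw [h1]
    simp only [neg_dotProduct, dotProduct_neg, add_dotProduct, dotProduct_add]
    rw [dotProduct_comm (H *ᵥ w) w]
    linarith

end SpectralNorm

/-! ### The two-to-infinity norm. -/

section TwoInfNorm

variable {m n k : ℕ}

lemma norm_row_le_norm2Inf (B : Matrix (Fin m) (Fin n) ℝ) (i : Fin m) :
    ‖(WithLp.toLp 2 (B i) : EuclideanSpace ℝ (Fin n))‖ ≤ norm2Inf B :=
  le_ciSup (f := fun i => ‖(WithLp.toLp 2 (B i) : EuclideanSpace ℝ (Fin n))‖)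
    (Set.finite_range _).bddAbove i

lemma norm2Inf_nonneg (B : Matrix (Fin m) (Fin n) ℝ) : 0 ≤ norm2Inf B :=
  Real.iSup_nonneg fun _ => norm_nonneg _

lemma norm2Inf_le {B : Matrix (Fin m) (Fin n) ℝ} {c : ℝ} (hc : 0 ≤ c)
    (h : ∀ i, ‖(WithLp.toLp 2 (B i) : EuclideanSpace ℝ (Fin n))‖ ≤ c) : norm2Inf B ≤ c :=
  Real.iSup_le h hc

lemma norm2Inf_add_le (B C : Matrix (Fin m) (Fin n) ℝ) :
    norm2Inf (B + C) ≤ norm2Inf B + norm2Inf C :=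
  norm2Inf_le (add_nonneg (norm2Inf_nonneg _) (norm2Inf_nonneg _)) fun i =>
    (norm_add_le (WithLp.toLp 2 (B i) : EuclideanSpace ℝ (Fin n)) (WithLp.toLp 2 (C i))).trans
      (add_le_add (norm_row_le_norm2Inf B i) (norm_row_le_norm2Inf C i))

lemma norm2Inf_smul (c : ℝ) (B : Matrix (Fin m) (Fin n) ℝ) :
    norm2Inf (c • B) = |c| * norm2Inf B := by
  rw [norm2Inf, norm2Inf, Real.mul_iSup_of_nonneg (abs_nonneg c)]
  refine iSup_congr fun i => ?_
  exact norm_smul c (WithLp.toLp 2 (B i) : EuclideanSpace ℝ (Fin n))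

lemma norm2Inf_neg (B : Matrix (Fin m) (Fin n) ℝ) : norm2Inf (-B) = norm2Inf B := by
  simpa using norm2Inf_smul (-1) B

lemma norm2Inf_sub_le (B C : Matrix (Fin m) (Fin n) ℝ) :
    norm2Inf (B - C) ≤ norm2Inf B + norm2Inf C := by
  rw [sub_eq_add_neg, ← norm2Inf_neg C]
  exact norm2Inf_add_le _ _

/-- Each row of the product is `Cᵀ` applied to a row of `B`. The asymmetry matters: only the right
factor is measured spectrally. -/
lemma norm2Inf_mul_le (B : Matrix (Fin m) (Fin n) ℝ) (C : Matrix (Fin n) (Fin k) ℝ) :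
    norm2Inf (B * C) ≤ norm2Inf B * ‖C‖ := by
  refine norm2Inf_le (mul_nonneg (norm2Inf_nonneg _) (norm_nonneg _)) fun i => ?_
  have h : (B * C) i = Cᵀ *ᵥ B i := by
    rw [mulVec_transpose]; rfl
  rw [h, ← l2_opNorm_transpose C, mul_comm]
  refine (norm_toLp_mulVec_le _ _).trans ?_
  gcongr
  exact norm_row_le_norm2Inf B i

lemma continuous_norm2Inf [NeZero m] :
    Continuous (norm2Inf : Matrix (Fin m) (Fin n) ℝ → ℝ) := by
  have h : (norm2Inf : Matrix (Fin m) (Fin n) ℝ → ℝ) = fun B =>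
      Finset.univ.sup' Finset.univ_nonempty
        fun i => ‖(WithLp.toLp 2 (B i) : EuclideanSpace ℝ (Fin n))‖ := by
    funext B
    rw [Finset.sup'_univ_eq_ciSup]
    rfl
  rw [h]
  refine Continuous.finset_sup'_apply _ fun i _ => ?_
  exact ((PiLp.continuous_toLp 2 _).comp (continuous_apply i)).norm

end TwoInfNorm

/-! ### Separation as a lower bound for the Sylvester operator. -/

section Sep

variable {l m k : ℕ}

/-- By homogeneity `Z` can be normalized to be a competitor in the infimum; if `ν Z = 0` the left
side vanishes. -/
lemma sepOn_mul_le {ν : Matrix (Fin m) (Fin l) ℝ → ℝ} (hν : ∀ Z, 0 ≤ ν Z)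
    (hsmul : ∀ (c : ℝ) Z, ν (c • Z) = |c| * ν Z) {W : Matrix (Fin m) (Fin k) ℝ}
    (B : Matrix (Fin l) (Fin l) ℝ) (C : Matrix (Fin m) (Fin m) ℝ) {Z : Matrix (Fin m) (Fin l) ℝ}
    (hZ : ∀ j, Z.col j ∈ LinearMap.range W.mulVecLin) :
    sepOn ν W B C * ν Z ≤ ν (Z * B - C * Z) := by
  rcases (hν Z).eq_or_lt with h0 | h0
  · rw [← h0, mul_zero]; exact hν _
  · rw [← le_div_iff₀ h0]
    refine csInf_le ⟨0, ?_⟩ ⟨(ν Z)⁻¹ • Z, fun j => ?_, ?_, ?_⟩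
    · rintro x ⟨Z, -, -, rfl⟩; exact hν _
    · exact Submodule.smul_mem _ _ (hZ j)
    · rw [hsmul, abs_of_pos (inv_pos.2 h0), inv_mul_cancel₀ h0.ne']
    · rw [Matrix.smul_mul, Matrix.mul_smul, ← smul_sub, hsmul, abs_of_pos (inv_pos.2 h0)]
      field_simp

lemma sep_mul_le {ν : Matrix (Fin m) (Fin l) ℝ → ℝ} (hν : ∀ Z, 0 ≤ ν Z)
    (hsmul : ∀ (c : ℝ) Z, ν (c • Z) = |c| * ν Z)
    (B : Matrix (Fin l) (Fin l) ℝ) (C : Matrix (Fin m) (Fin m) ℝ) (Z : Matrix (Fin m) (Fin l) ℝ) :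
    sep ν B C * ν Z ≤ ν (Z * B - C * Z) := by
  have h : sep ν B C = sepOn ν (1 : Matrix (Fin m) (Fin m) ℝ) B C := by
    simp [sep, sepOn]
  rw [h]
  exact sepOn_mul_le hν hsmul B C fun j => by simp

end Sep

end RowPerturb

namespace RowPerturb

open scoped Matrix.Norms.L2Operator
open Matrix

lemma norm2_smul {k l : ℕ} (c : ℝ) (Z : Matrix (Fin k) (Fin l) ℝ) :
    norm2 (c • Z) = |c| * norm2 Z :=
  norm_smul c Z

/-! ### Angles between dominant subspaces and the Riccati equation. -/

section EigenDecomp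

variable {n r : ℕ} {hrn : r ≤ n} {A M : Matrix (Fin n) (Fin n) ℝ} {lam mu : Fin n → ℝ}
  {V₁ W₁ : Matrix (Fin n) (Fin r) ℝ} {V₂ W₂ : Matrix (Fin n) (Fin (n - r)) ℝ}

namespace IsEigenDecomp

lemma orthogonal' (h : IsEigenDecomp hrn A lam V₁ V₂) : V₂ᵀ * V₁ = 0 := by
  simpa using congrArg transpose h.orthogonal

/-- `[V₁ | V₂]` is square because `r + (n - r) = n`, so its left inverse is also a right inverse. -/
lemma complete (h : IsEigenDecomp hrn A lam V₁ V₂) : V₁ * V₁ᵀ + V₂ * V₂ᵀ = 1 := by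
  rw [← fromCols_mul_fromRows]
  refine (mul_eq_one_comm_of_card_eq _ _ _ (by simp [hrn])).1 ?_
  rw [fromRows_mul_fromCols, h.orthonormal₁, h.orthonormal₂, h.orthogonal, h.orthogonal',
    fromBlocks_one]

lemma mul_left (h : IsEigenDecomp hrn A lam V₁ V₂) : A * V₁ = V₁ * topDiag hrn lam := by
  rw [h.decomp, Matrix.add_mul, Matrix.mul_assoc, h.orthonormal₁, Matrix.mul_assoc (V₂ * _),
    h.orthogonal', Matrix.mul_one, Matrix.mul_zero, add_zero]

lemma transpose_mul_left (h : IsEigenDecomp hrn A lam V₁ V₂) :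
    V₁ᵀ * A = topDiag hrn lam * V₁ᵀ := by
  rw [h.decomp, Matrix.mul_add, ← Matrix.mul_assoc, ← Matrix.mul_assoc, h.orthonormal₁,
    ← Matrix.mul_assoc, ← Matrix.mul_assoc, h.orthogonal, Matrix.one_mul, Matrix.zero_mul,
    Matrix.zero_mul, add_zero]

lemma transpose_mul_right (h : IsEigenDecomp hrn A lam V₁ V₂) :
    V₂ᵀ * A = botDiag hrn lam * V₂ᵀ := by
  rw [h.decomp, Matrix.mul_add, ← Matrix.mul_assoc, ← Matrix.mul_assoc, h.orthogonal',
    ← Matrix.mul_assoc, ← Matrix.mul_assoc, h.orthonormal₂, Matrix.one_mul, Matrix.zero_mul,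
    Matrix.zero_mul, zero_add]

lemma decompose {k : ℕ} (h : IsEigenDecomp hrn A lam V₁ V₂) (B : Matrix (Fin n) (Fin k) ℝ) :
    B = V₁ * (V₁ᵀ * B) + V₂ * (V₂ᵀ * B) := by
  rw [← Matrix.mul_assoc, ← Matrix.mul_assoc, ← Matrix.add_mul, h.complete, Matrix.one_mul]

lemma cos_sq_add_sin_sq (h : IsEigenDecomp hrn A lam V₁ V₂) (hW : W₁ᵀ * W₁ = 1) :
    (V₁ᵀ * W₁)ᵀ * (V₁ᵀ * W₁) + (V₂ᵀ * W₁)ᵀ * (V₂ᵀ * W₁) = 1 := by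
  simp only [transpose_mul, transpose_transpose, Matrix.mul_assoc]
  rw [← Matrix.mul_add, ← h.decompose, hW]

lemma dotProduct_cos_add_sin (h : IsEigenDecomp hrn A lam V₁ V₂) (hW : W₁ᵀ * W₁ = 1)
    (v : Fin r → ℝ) :
    ((V₁ᵀ * W₁) *ᵥ v) ⬝ᵥ ((V₁ᵀ * W₁) *ᵥ v) + ((V₂ᵀ * W₁) *ᵥ v) ⬝ᵥ ((V₂ᵀ * W₁) *ᵥ v) =
      v ⬝ᵥ v := by
  rw [mulVec_dotProduct_mulVec, mulVec_dotProduct_mulVec, ← dotProduct_add, ← add_mulVec,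
    h.cos_sq_add_sin_sq hW, one_mulVec]

lemma le_dotProduct_cos (h : IsEigenDecomp hrn A lam V₁ V₂) (hW : W₁ᵀ * W₁ = 1) {s : ℝ}
    (hs : ‖V₂ᵀ * W₁‖ ≤ s) (v : Fin r → ℝ) :
    (1 - s ^ 2) * (v ⬝ᵥ v) ≤ ((V₁ᵀ * W₁) *ᵥ v) ⬝ᵥ ((V₁ᵀ * W₁) *ᵥ v) := by
  have h1 := h.dotProduct_cos_add_sin hW v
  have h2 := dotProduct_mulVec_self_le (V₂ᵀ * W₁) v
  have h3 : ‖V₂ᵀ * W₁‖ ^ 2 * (v ⬝ᵥ v) ≤ s ^ 2 * (v ⬝ᵥ v) := by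
    gcongr
    exact dotProduct_self_nonneg' v
  linarith

/-- The `sin Θ` theorem for two ordered spectra. -/
lemma sin_theta (h : IsEigenDecomp hrn A lam V₁ V₂) (h' : IsEigenDecomp hrn M mu W₁ W₂)
    {α β : ℝ} (hβα : β < α) (hα : ∀ i : Fin r, α ≤ mu ⟨i, i.isLt.trans_le hrn⟩)
    (hβ : ∀ j : Fin (n - r), lam ⟨r + j, by omega⟩ ≤ β) :
    (α - β) * ‖V₂ᵀ * W₁‖ ≤ ‖M - A‖ := by
  refine (sub_mul_l2_opNorm_le_sylvester hβα hα hβ (V₂ᵀ * W₁)).trans ?_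
  have h1 : V₂ᵀ * W₁ * topDiag hrn mu - botDiag hrn lam * (V₂ᵀ * W₁) = V₂ᵀ * (M - A) * W₁ := by
    rw [Matrix.mul_assoc, ← h'.mul_left, ← Matrix.mul_assoc (botDiag hrn lam),
      ← h.transpose_mul_right, Matrix.mul_sub, Matrix.sub_mul,
      Matrix.mul_assoc, Matrix.mul_assoc]
  change ‖V₂ᵀ * W₁ * topDiag hrn mu - botDiag hrn lam * (V₂ᵀ * W₁)‖ ≤ _
  rw [h1]
  exact l2_opNorm_compress_le h.orthonormal₂ h'.orthonormal₁ _

lemma le_top (h : IsEigenDecomp hrn A lam V₁ V₂) {p : Fin n} (hp : p.1 = r - 1) (i : Fin r) :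
    lam p ≤ lam ⟨i, i.isLt.trans_le hrn⟩ :=
  h.antitone (Fin.mk_le_mk.2 (by omega))

lemma bot_le (h : IsEigenDecomp hrn A lam V₁ V₂) {q : Fin n} (hq : q.1 = r)
    (j : Fin (n - r)) : lam ⟨r + j, by omega⟩ ≤ lam q :=
  h.antitone (Fin.mk_le_mk.2 (by omega))

/-- If the perturbation is at most a fifth of the eigenvalue gap, the cosine matrix of the two
dominant subspaces is boundedly invertible. -/
lemma isUnit_cos (h : IsEigenDecomp hrn A lam V₁ V₂) (h' : IsEigenDecomp hrn M mu W₁ W₂)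
    {p q : Fin n} (hp : p.1 = r - 1) (hq : q.1 = r) (hlam : lam q < lam p)
    (hE : ‖M - A‖ ≤ (lam p - lam q) / 5) :
    IsUnit (V₁ᵀ * W₁).det ∧ ‖(V₁ᵀ * W₁)⁻¹‖ ^ 2 ≤ 25 / 21 := by
  set c := (lam p + lam q) / 2 with hc
  -- The midpoint `c` replaces Weyl's inequality: either `mu p` is at least `c`, or the whole lower
  -- perturbed spectrum is below it. Each case leaves a gap `δ/2` for a sin Θ bound, so the sine is
  -- at most `(δ/5)/(δ/2) = 2/5` and the squared cosine at least `21/25`.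
  by_cases hmu : c ≤ mu p
  · have h1 := h.sin_theta h' (α := c) (β := lam q) (by linarith)
      (fun i => hmu.trans (h'.le_top hp i)) (h.bot_le hq)
    have h2 : ‖V₂ᵀ * W₁‖ ≤ 2 / 5 := by
      have h3 : 0 < lam p - lam q := by linarith
      have h4 : (c - lam q) = (lam p - lam q) / 2 := by rw [hc]; ring
      rw [h4] at h1
      by_contra! h5
      nlinarith
    have h3 := h.le_dotProduct_cos h'.orthonormal₁ h2
    refine ⟨isUnit_det_of_dotProduct_le (by norm_num) h3,
      (l2_opNorm_inv_sq_le (by norm_num) h3).trans (by norm_num)⟩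
  · push Not at hmu
    -- The roles of the two decompositions are exchanged; the resulting cosine matrix is the
    -- transpose of the required one.
    have h1 := h'.sin_theta h (α := lam p) (β := c) (by linarith) (h.le_top hp)
      (fun j => (h'.bot_le hq j).trans ((h'.antitone (by
        rw [Fin.le_def, hp, hq]; omega)).trans hmu.le))
    rw [norm_sub_rev] at h1
    have h2 : ‖W₂ᵀ * V₁‖ ≤ 2 / 5 := by
      have h3 : 0 < lam p - lam q := by linarith
      have h4 : (lam p - c) = (lam p - lam q) / 2 := by rw [hc]; ring
      rw [h4] at h1
      by_contra! h5
      nlinarith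
    have h3 := h'.le_dotProduct_cos h.orthonormal₁ h2
    have h4 : W₁ᵀ * V₁ = (V₁ᵀ * W₁)ᵀ := by simp
    have h5 := isUnit_det_of_dotProduct_le (by norm_num) h3
    have h6 := l2_opNorm_inv_sq_le (by norm_num) h3
    rw [h4, det_transpose] at h5
    rw [h4, ← transpose_nonsing_inv, l2_opNorm_transpose] at h6
    exact ⟨h5, h6.trans (by norm_num)⟩

/-- The tangent matrix of the dominant subspaces has norm at most `1 / 2`. -/
lemma norm_tan_le_half (h : IsEigenDecomp hrn A lam V₁ V₂) (hW : W₁ᵀ * W₁ = 1)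
    (hu : IsUnit (V₁ᵀ * W₁).det) (hinv : ‖(V₁ᵀ * W₁)⁻¹‖ ^ 2 ≤ 25 / 21) :
    ‖V₂ᵀ * W₁ * (V₁ᵀ * W₁)⁻¹‖ ≤ 1 / 2 := by
  refine l2_opNorm_le_of_dotProduct_le (by norm_num) fun v => ?_
  have h1 := h.dotProduct_cos_add_sin hW ((V₁ᵀ * W₁)⁻¹ *ᵥ v)
  have h2 := dotProduct_mulVec_self_le (V₁ᵀ * W₁)⁻¹ v
  have h3 := dotProduct_self_nonneg' v
  rw [mulVec_mulVec, mul_nonsing_inv _ hu, one_mulVec] at h1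
  rw [← mulVec_mulVec]
  -- `tan² = 1/cos² - 1 ≤ 25/21 - 1 = 4/21 < 1/4`.
  nlinarith

/-- The Riccati equation satisfied by the tangent matrix. -/
lemma riccati {E : Matrix (Fin n) (Fin n) ℝ} (h : IsEigenDecomp hrn A lam V₁ V₂)
    (h' : IsEigenDecomp hrn (A + E) mu W₁ W₂) (hu : IsUnit (V₁ᵀ * W₁).det)
    {X : Matrix (Fin (n - r)) (Fin r) ℝ} (hX : X = V₂ᵀ * W₁ * (V₁ᵀ * W₁)⁻¹) :
    X * topDiag hrn lam - botDiag hrn lam * X =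
      V₂ᵀ * E * V₁ + V₂ᵀ * E * V₂ * X - X * (V₁ᵀ * E * V₁) - X * (V₁ᵀ * E * V₂) * X := by
  set P := V₁ᵀ * W₁ with hP
  have hT : W₁ * P⁻¹ = V₁ + V₂ * X := by
    conv_lhs => rw [h.decompose W₁]
    rw [← hP, Matrix.add_mul, Matrix.mul_assoc, mul_nonsing_inv _ hu, Matrix.mul_one, hX,
      Matrix.mul_assoc, Matrix.mul_assoc]
  -- `K` represents `A + E` in the basis `V₁ + V₂ X`. The `V₁ᵀ` component of the invariance equation
  -- determines `K`; substituting it into the `V₂ᵀ` component gives the Riccati equation.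
  set K := P * topDiag hrn mu * P⁻¹ with hK
  have hK' : (A + E) * (V₁ + V₂ * X) = (V₁ + V₂ * X) * K := by
    rw [← hT, ← Matrix.mul_assoc, h'.mul_left, hK]
    simp only [Matrix.mul_assoc]
    rw [← Matrix.mul_assoc P⁻¹ P, nonsing_inv_mul _ hu, Matrix.one_mul]
  have h1 : V₁ᵀ * (V₁ + V₂ * X) = 1 := by
    rw [Matrix.mul_add, h.orthonormal₁, ← Matrix.mul_assoc, h.orthogonal, Matrix.zero_mul, add_zero]
  have h2 : V₂ᵀ * (V₁ + V₂ * X) = X := by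
    rw [Matrix.mul_add, h.orthogonal', ← Matrix.mul_assoc, h.orthonormal₂, Matrix.one_mul, zero_add]
  have e1 : topDiag hrn lam + (V₁ᵀ * E * V₁ + V₁ᵀ * E * V₂ * X) = K := by
    have := congrArg (V₁ᵀ * ·) hK'
    rw [← Matrix.mul_assoc V₁ᵀ, ← Matrix.mul_assoc V₁ᵀ, h1, Matrix.one_mul, Matrix.mul_add V₁ᵀ,
      Matrix.add_mul (V₁ᵀ * A), h.transpose_mul_left,
      Matrix.mul_assoc (topDiag hrn lam), h1, Matrix.mul_one, Matrix.mul_add,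
      ← Matrix.mul_assoc _ V₂ X] at this
    exact this
  have e2 : botDiag hrn lam * X + (V₂ᵀ * E * V₁ + V₂ᵀ * E * V₂ * X) = X * K := by
    have := congrArg (V₂ᵀ * ·) hK'
    rw [← Matrix.mul_assoc V₂ᵀ, ← Matrix.mul_assoc V₂ᵀ, h2, Matrix.mul_add V₂ᵀ,
      Matrix.add_mul (V₂ᵀ * A), h.transpose_mul_right,
      Matrix.mul_assoc (botDiag hrn lam), h2, Matrix.mul_add,
      ← Matrix.mul_assoc _ V₂ X] at this
    exact this
  rw [← e1, Matrix.mul_add, Matrix.mul_add, ← Matrix.mul_assoc X _ X] at e2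
  rw [← sub_eq_zero] at e2 ⊢
  rw [← neg_eq_zero, ← e2]
  abel

/-- For ordered spectra the spectral separation is the eigenvalue gap. -/
lemma sep_eq (h : IsEigenDecomp hrn A lam V₁ V₂) (hr : 0 < r) {p q : Fin n} (hp : p.1 = r - 1)
    (hq : q.1 = r) (hlam : lam q < lam p) :
    sep norm2 (topDiag hrn lam) (botDiag hrn lam) = lam p - lam q := by
  have hZ0 : ∃ Z : Matrix (Fin (n - r)) (Fin r) ℝ, Z ≠ 0 ∧
      Z * topDiag hrn lam - botDiag hrn lam * Z = (lam p - lam q) • Z := by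
    -- This matrix unit pairs `λ_r` with `λ_{r+1}`, so it is an eigenvector of the Sylvester
    -- operator for the gap.
    refine ⟨single ⟨0, by omega⟩ ⟨r - 1, by omega⟩ 1, fun h0 => ?_, ?_⟩
    · have := congrFun (congrFun h0 ⟨0, by omega⟩) ⟨r - 1, by omega⟩
      simp at this
    · have hp' : lam p = lam ⟨r - 1, by omega⟩ := congrArg lam (Fin.ext hp)
      have hq' : lam q = lam ⟨r, by omega⟩ := congrArg lam (Fin.ext hq)
      rw [topDiag, botDiag, hp', hq']
      ext i j
      simp only [Matrix.sub_apply, mul_diagonal, diagonal_mul, Matrix.smul_apply, single_apply,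
        smul_eq_mul]
      split_ifs with hij
      · obtain ⟨rfl, rfl⟩ := hij
        simp
      · simp
  obtain ⟨Z, hZ, hZe⟩ := hZ0
  have hZp : 0 < ‖Z‖ := norm_pos_iff.2 hZ
  refine le_antisymm ?_ ?_
  · have h1 := sep_mul_le (ν := norm2) (fun _ => norm_nonneg _) norm2_smul
      (topDiag hrn lam) (botDiag hrn lam) Z
    rw [hZe] at h1
    have h2 : norm2 ((lam p - lam q) • Z) = (lam p - lam q) * ‖Z‖ := by
      rw [norm2, norm_smul, Real.norm_of_nonneg (by linarith)]
    rw [h2] at h1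
    exact le_of_mul_le_mul_right h1 hZp
  · refine le_csInf ⟨_, ‖Z‖⁻¹ • Z, ?_, rfl⟩ ?_
    · rw [norm2, norm_smul, norm_inv, norm_norm, inv_mul_cancel₀ hZp.ne']
    · rintro x ⟨Z, hZ1, rfl⟩
      have := sub_mul_l2_opNorm_le_sylvester hlam (h.le_top hp) (h.bot_le hq) Z
      rw [norm2] at hZ1
      rwa [hZ1, mul_one] at this

end IsEigenDecomp

/-- Bound on the tangent matrix in terms of the spectral separation. -/
lemma norm_le_of_riccati {k l : ℕ} {δ ε : ℝ} (hδ : 0 < δ) (hε : ε ≤ δ / 5)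
    {X R E₂₁ : Matrix (Fin k) (Fin l) ℝ}
    {E₁₁ : Matrix (Fin l) (Fin l) ℝ} {E₁₂ : Matrix (Fin l) (Fin k) ℝ}
    {E₂₂ : Matrix (Fin k) (Fin k) ℝ} (h₁₁ : ‖E₁₁‖ ≤ ε) (h₁₂ : ‖E₁₂‖ ≤ ε) (h₂₂ : ‖E₂₂‖ ≤ ε)
    (hX : ‖X‖ ≤ 1 / 2) (hR : R = E₂₁ + E₂₂ * X - X * E₁₁ - X * E₁₂ * X)
    (hsep : δ * ‖X‖ ≤ ‖R‖) : ‖X‖ ≤ 2 * (‖E₂₁‖ / δ) := by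
  have h1 : ‖R‖ ≤ ‖E₂₁‖ + ‖E₂₂‖ * ‖X‖ + ‖X‖ * ‖E₁₁‖ + ‖X‖ * ‖E₁₂‖ * ‖X‖ := by
    rw [hR]
    refine (norm_sub_le _ _).trans (add_le_add ((norm_sub_le _ _).trans (add_le_add
      ((norm_add_le _ _).trans (add_le_add le_rfl (l2_opNorm_mul _ _)))
      (l2_opNorm_mul _ _))) ?_)
    exact (l2_opNorm_mul _ _).trans (by gcongr; exact l2_opNorm_mul _ _)
  have hx := norm_nonneg X
  have h2 : ‖E₂₂‖ * ‖X‖ ≤ δ / 5 * ‖X‖ := by gcongr; linarith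
  have h3 : ‖X‖ * ‖E₁₁‖ ≤ ‖X‖ * (δ / 5) := by gcongr; linarith
  have h4 : ‖X‖ * ‖E₁₂‖ * ‖X‖ ≤ ‖X‖ * (δ / 5) * (1 / 2) := by gcongr; linarith
  rw [← mul_div_assoc, le_div_iff₀ hδ]
  -- The absorbed coefficients are `1/5 + 1/5 + 1/10 = 1/2`, whence the factor `2`.
  linarith

end EigenDecomp

end RowPerturb

namespace RowPerturb

open scoped Matrix.Norms.L2Operator
open Matrix

/-! ### Row-wise bounds and alignment. -/

section RowWise

variable {n r : ℕ} {hrn : r ≤ n} {A E : Matrix (Fin n) (Fin n) ℝ} {lam mu : Fin n → ℝ}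
  {V₁ W₁ : Matrix (Fin n) (Fin r) ℝ} {V₂ W₂ : Matrix (Fin n) (Fin (n - r)) ℝ}

/-- Row-wise bound on `V₂ X` for a solution `X` of the Riccati equation. -/
lemma norm2Inf_mul_le_of_riccati {g : ℝ} (hg : 0 < g) (hV₂ : V₂ᵀ * V₂ = 1)
    {X : Matrix (Fin (n - r)) (Fin r) ℝ} {Λ₁ E₁₁ : Matrix (Fin r) (Fin r) ℝ}
    {Λ₂ E₂₂ : Matrix (Fin (n - r)) (Fin (n - r)) ℝ} {E₂₁ : Matrix (Fin (n - r)) (Fin r) ℝ}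
    {E₁₂ : Matrix (Fin r) (Fin (n - r)) ℝ} (h₁₁ : ‖E₁₁‖ ≤ g / 5) (h₁₂ : ‖E₁₂‖ ≤ g / 5)
    (hX : ‖X‖ ≤ 1 / 2)
    (hR : X * Λ₁ - Λ₂ * X = E₂₁ + E₂₂ * X - X * E₁₁ - X * E₁₂ * X)
    (hsep : g ≤ sepOn norm2Inf V₂ Λ₁ (V₂ * Λ₂ * V₂ᵀ)) :
    norm2Inf (V₂ * X) ≤
      2 * (norm2Inf (V₂ * E₂₁) / g) + 2 * (norm2Inf (V₂ * E₂₂ * V₂ᵀ) * ‖X‖ / g) := by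
  have hY : V₂ * X * Λ₁ - V₂ * Λ₂ * V₂ᵀ * (V₂ * X) =
      V₂ * E₂₁ + V₂ * E₂₂ * V₂ᵀ * (V₂ * X) - V₂ * X * E₁₁ - V₂ * X * (E₁₂ * X) := by
    have h1 : ∀ B : Matrix (Fin (n - r)) (Fin (n - r)) ℝ,
        V₂ * B * V₂ᵀ * (V₂ * X) = V₂ * (B * X) := fun B => by
      rw [Matrix.mul_assoc (V₂ * B), ← Matrix.mul_assoc V₂ᵀ, hV₂, Matrix.one_mul, Matrix.mul_assoc]
    rw [h1, h1, Matrix.mul_assoc, ← Matrix.mul_sub, hR]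
    simp only [Matrix.mul_add, Matrix.mul_sub, Matrix.mul_assoc]
  have h1 : sepOn norm2Inf V₂ Λ₁ (V₂ * Λ₂ * V₂ᵀ) * norm2Inf (V₂ * X) ≤
      norm2Inf (V₂ * X * Λ₁ - V₂ * Λ₂ * V₂ᵀ * (V₂ * X)) :=
    sepOn_mul_le norm2Inf_nonneg norm2Inf_smul _ _ fun j => ⟨X.col j, rfl⟩
  have hy := norm2Inf_nonneg (V₂ * X)
  have h2 : norm2Inf (V₂ * X * Λ₁ - V₂ * Λ₂ * V₂ᵀ * (V₂ * X)) ≤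
      norm2Inf (V₂ * E₂₁) + norm2Inf (V₂ * E₂₂ * V₂ᵀ) * ‖X‖ + norm2Inf (V₂ * X) * (g / 5)
        + norm2Inf (V₂ * X) * (g / 5 * (1 / 2)) := by
    rw [hY]
    refine (norm2Inf_sub_le _ _).trans (add_le_add ((norm2Inf_sub_le _ _).trans (add_le_add
      ((norm2Inf_add_le _ _).trans (add_le_add le_rfl ?_)) ?_)) ?_)
    -- Here `V₂ X` is the right factor and is measured spectrally, so this term cannot be absorbed;
    -- it becomes the `E₂₂` term of the final bound.
    · refine (norm2Inf_mul_le _ _).trans (mul_le_mul_of_nonneg_left ?_ (norm2Inf_nonneg _))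
      refine (l2_opNorm_mul _ _).trans ?_
      have := l2_opNorm_le_one_of_orthonormal hV₂
      nlinarith [norm_nonneg X]
    · exact (norm2Inf_mul_le _ _).trans (mul_le_mul_of_nonneg_left h₁₁ hy)
    · refine (norm2Inf_mul_le _ _).trans (mul_le_mul_of_nonneg_left ?_ hy)
      exact (l2_opNorm_mul _ _).trans (by gcongr)
  have h3 : g * norm2Inf (V₂ * X) ≤
      sepOn norm2Inf V₂ Λ₁ (V₂ * Λ₂ * V₂ᵀ) * norm2Inf (V₂ * X) := by gcongr
  rw [← mul_div_assoc, ← mul_div_assoc, ← add_div, le_div_iff₀ hg]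
  -- Absorption leaves `1 - 1/5 - 1/10 = 7/10 ≥ 1/2` of `g` on the left.
  nlinarith

/-- Alignment of the two dominant bases through the polar factor of the cosine matrix. -/
lemma IsEigenDecomp.exists_orthogonal_norm2Inf_le (h : IsEigenDecomp hrn A lam V₁ V₂)
    (hW : W₁ᵀ * W₁ = 1) (hu : IsUnit (V₁ᵀ * W₁).det)
    {X : Matrix (Fin (n - r)) (Fin r) ℝ} (hX : X = V₂ᵀ * W₁ * (V₁ᵀ * W₁)⁻¹) :
    ∃ U ∈ orthogonalGroup (Fin r) ℝ,
      norm2Inf (W₁ * U - V₁) ≤ norm2Inf V₁ * ‖X‖ ^ 2 + norm2Inf (V₂ * X) := by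
  set P := V₁ᵀ * W₁ with hP
  have hXP : X * P = V₂ᵀ * W₁ := by
    rw [hX, Matrix.mul_assoc, nonsing_inv_mul _ hu, Matrix.mul_one]
  have hP1 : ‖P‖ ≤ 1 := by
    have h1 := l2_opNorm_le_one_of_orthonormal h.orthonormal₁
    have h2 := l2_opNorm_le_one_of_orthonormal hW
    rw [← l2_opNorm_transpose] at h1
    exact (l2_opNorm_mul _ _).trans (mul_le_one₀ h1 (norm_nonneg _) h2)
  have hPP : 1 - P * Pᵀ = Xᵀ * X * (P * Pᵀ) := by
    have h1 := h.cos_sq_add_sin_sq hW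
    rw [← hP, ← hXP] at h1
    have h2 : Pᵀ * ((1 + Xᵀ * X) * P) = 1 := by
      rw [transpose_mul X P] at h1
      refine Eq.trans ?_ h1
      simp only [Matrix.add_mul, Matrix.mul_add, Matrix.mul_assoc, Matrix.one_mul]
    -- Cycling `Pᵀ` to the right turns `cos² + sin² = 1` into `(1 + Xᵀ X) P Pᵀ = 1`.
    have h3 := mul_eq_one_comm.1 h2
    rw [Matrix.mul_assoc, Matrix.add_mul, Matrix.one_mul] at h3
    rw [← h3, add_sub_cancel_left]
  have hPn : ‖1 - P * Pᵀ‖ ≤ ‖X‖ ^ 2 := by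
    rw [hPP]
    have h1 : ‖Xᵀ * X‖ ≤ ‖X‖ ^ 2 := by
      refine (l2_opNorm_mul _ _).trans ?_
      rw [l2_opNorm_transpose, sq]
    have h2 : ‖P * Pᵀ‖ ≤ 1 := by
      refine (l2_opNorm_mul _ _).trans ?_
      rw [l2_opNorm_transpose]
      exact mul_le_one₀ hP1 (norm_nonneg _) hP1
    calc _ ≤ ‖Xᵀ * X‖ * ‖P * Pᵀ‖ := l2_opNorm_mul _ _
      _ ≤ ‖X‖ ^ 2 * 1 := by gcongr
      _ = _ := mul_one _
  obtain ⟨U, hU, hU1, hU2⟩ := exists_polar hu hP1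
  refine ⟨U, hU, ?_⟩
  have hdec : W₁ * U - V₁ = V₁ * (P * U - 1) + V₂ * X * (P * U) := by
    conv_lhs => rw [h.decompose W₁]
    rw [← hP, ← hXP]
    simp only [Matrix.add_mul, Matrix.mul_sub, Matrix.mul_assoc, Matrix.mul_one]
    abel
  rw [hdec]
  refine (norm2Inf_add_le _ _).trans (add_le_add ?_ ?_)
  · exact (norm2Inf_mul_le _ _).trans
      (mul_le_mul_of_nonneg_left (hU2.trans hPn) (norm2Inf_nonneg _))
  · exact (norm2Inf_mul_le _ _).trans
      (mul_le_of_le_one_right (norm2Inf_nonneg _) hU1)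

lemma IsEigenDecomp.exists_orthogonal_norm2Inf_le_of_gap (h : IsEigenDecomp hrn A lam V₁ V₂)
    (h' : IsEigenDecomp hrn (A + E) mu W₁ W₂) (hr : 0 < r) {p q : Fin n} (hp : p.1 = r - 1)
    (hq : q.1 = r) (hlam : lam q < lam p) (hgap : ‖E‖ ≤ gap hrn lam V₂ / 5) :
    ∃ U ∈ orthogonalGroup (Fin r) ℝ,
      norm2Inf (W₁ * U - V₁) ≤
        4 * norm2Inf V₁ * (‖V₂ᵀ * E * V₁‖ / (lam p - lam q)) ^ 2
          + 2 * (norm2Inf (V₂ * (V₂ᵀ * E * V₁)) / gap hrn lam V₂)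
          + 4 * (norm2Inf (V₂ * (V₂ᵀ * E * V₂) * V₂ᵀ) * ‖V₂ᵀ * E * V₁‖ /
              (gap hrn lam V₂ * (lam p - lam q))) := by
  have hδ : 0 < lam p - lam q := sub_pos.2 hlam
  have hsep := h.sep_eq hr hp hq hlam
  have hgδ : gap hrn lam V₂ ≤ lam p - lam q := hsep ▸ min_le_left _ _
  have hgs : gap hrn lam V₂ ≤ sepOn norm2Inf V₂ (topDiag hrn lam) (V₂ * botDiag hrn lam * V₂ᵀ) :=
    min_le_right _ _
  set δ := lam p - lam q
  set g := gap hrn lam V₂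
  have hEδ : ‖E‖ ≤ δ / 5 := by linarith
  obtain ⟨hu, hinv⟩ := h.isUnit_cos h' hp hq hlam (by rwa [add_sub_cancel_left])
  have hX2 := h.norm_tan_le_half h'.orthonormal₁ hu hinv
  obtain ⟨X, hX⟩ : ∃ X, X = V₂ᵀ * W₁ * (V₁ᵀ * W₁)⁻¹ := ⟨_, rfl⟩
  rw [← hX] at hX2
  have hric := h.riccati h' hu hX
  have h₁₁ := l2_opNorm_compress_le h.orthonormal₁ h.orthonormal₁ E
  have h₁₂ := l2_opNorm_compress_le h.orthonormal₁ h.orthonormal₂ E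
  have h₂₂ := l2_opNorm_compress_le h.orthonormal₂ h.orthonormal₂ E
  have hXe : ‖X‖ ≤ 2 * (‖V₂ᵀ * E * V₁‖ / δ) := by
    refine norm_le_of_riccati hδ hEδ h₁₁ h₁₂ h₂₂ hX2 hric ?_
    exact sub_mul_l2_opNorm_le_sylvester hlam (h.le_top hp) (h.bot_le hq) X
  have hY : norm2Inf (V₂ * X) ≤ 2 * (norm2Inf (V₂ * (V₂ᵀ * E * V₁)) / g)
      + 4 * (norm2Inf (V₂ * (V₂ᵀ * E * V₂) * V₂ᵀ) * ‖V₂ᵀ * E * V₁‖ / (g * δ)) := by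
    have hg0 : 0 ≤ g := by linarith [norm_nonneg E]
    have ha := norm2Inf_nonneg (V₂ * (V₂ᵀ * E * V₁))
    have hb := norm2Inf_nonneg (V₂ * (V₂ᵀ * E * V₂) * V₂ᵀ)
    -- Positivity of `g` is never needed: `g = 0` forces `E = 0`, hence `X = 0`, and the right side
    -- is nonnegative.
    rcases hg0.eq_or_lt with hg | hg
    · have hE0 : E = 0 := norm_le_zero_iff.1 (by linarith)
      have hX0 : X = 0 := norm_le_zero_iff.1 (by simpa [hE0] using hXe)
      have : norm2Inf (V₂ * X) = 0 := by
        simpa [hX0] using norm2Inf_smul 0 (V₂ * X)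
      rw [this]
      positivity
    · refine (norm2Inf_mul_le_of_riccati hg h.orthonormal₂ (h₁₁.trans hgap) (h₁₂.trans hgap) hX2
        hric hgs).trans (add_le_add le_rfl ?_)
      calc _ ≤ 2 * (norm2Inf (V₂ * (V₂ᵀ * E * V₂) * V₂ᵀ) * (2 * (‖V₂ᵀ * E * V₁‖ / δ)) / g) := by
            gcongr
        _ = _ := by field_simp; ring
  obtain ⟨U, hU, hUle⟩ := h.exists_orthogonal_norm2Inf_le h'.orthonormal₁ hu hX
  refine ⟨U, hU, hUle.trans ?_⟩
  have h1 : norm2Inf V₁ * ‖X‖ ^ 2 ≤ norm2Inf V₁ * (2 * (‖V₂ᵀ * E * V₁‖ / δ)) ^ 2 := by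
    gcongr
    exact norm2Inf_nonneg _
  linarith

end RowWise

/-! ### Change of basis and attainment of the minimum. -/

/-- Two orthonormal bases of the same subspace differ by an orthogonal matrix. -/
lemma exists_orthogonal_of_range_eq {n r : ℕ} {V W : Matrix (Fin n) (Fin r) ℝ}
    (hV : Vᵀ * V = 1) (hW : Wᵀ * W = 1)
    (h : LinearMap.range V.mulVecLin = LinearMap.range W.mulVecLin) :
    ∃ Q ∈ orthogonalGroup (Fin r) ℝ, V * Q = W := by
  have hcol : ∀ j, ∃ v, V *ᵥ v = W.col j := fun j => by
    have : W.col j ∈ LinearMap.range W.mulVecLin := ⟨Pi.single j 1, by simp⟩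
    rw [← h] at this
    exact this
  choose f hf using hcol
  have hQ : V * (of f)ᵀ = W := by
    ext i j
    exact congrFun (hf j) i
  refine ⟨(of f)ᵀ, ?_, hQ⟩
  rw [mem_orthogonalGroup_iff']
  rw [← hQ, transpose_mul, Matrix.mul_assoc, ← Matrix.mul_assoc Vᵀ, hV, Matrix.one_mul] at hW
  exact hW

lemma isCompact_orthogonalGroup (r : ℕ) :
    IsCompact (orthogonalGroup (Fin r) ℝ : Set (Matrix (Fin r) (Fin r) ℝ)) := by
  have : ProperSpace (Matrix (Fin r) (Fin r) ℝ) := FiniteDimensional.proper ℝ _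
  refine Metric.isCompact_of_isClosed_isBounded ?_ ?_
  · have : (orthogonalGroup (Fin r) ℝ : Set (Matrix (Fin r) (Fin r) ℝ)) =
        {U | U * Uᵀ = 1} := by
      ext U
      exact mem_orthogonalGroup_iff _ _
    rw [this]
    exact isClosed_eq (by fun_prop) continuous_const
  · refine isBounded_iff_forall_norm_le.2 ⟨1, fun U hU => ?_⟩
    exact l2_opNorm_le_one_of_orthonormal ((mem_orthogonalGroup_iff' _ _).1 hU)

lemma exists_isLeast_norm2Inf {n r : ℕ} [NeZero n] (V W : Matrix (Fin n) (Fin r) ℝ) :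
    ∃ d, IsLeast {x : ℝ | ∃ U ∈ orthogonalGroup (Fin r) ℝ, x = norm2Inf (V * U - W)} d := by
  obtain ⟨U, hU, hmin⟩ := (isCompact_orthogonalGroup r).exists_isMinOn ⟨1, one_mem _⟩
    (f := fun U => norm2Inf (V * U - W)) (continuous_norm2Inf.comp (by fun_prop)).continuousOn
  refine ⟨_, ⟨U, hU, rfl⟩, ?_⟩
  rintro x ⟨U', hU', rfl⟩
  exact hmin hU'

end RowPerturb

theorem corollary3p2 {n r : ℕ} (hr : 0 < r) (hrn : r < n)
    (A E : Matrix (Fin n) (Fin n) ℝ) (hA : A.IsSymm) (hE : E.IsSymm)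
    (lam : Fin n → ℝ) (V₁ : Matrix (Fin n) (Fin r) ℝ) (V₂ : Matrix (Fin n) (Fin (n - r)) ℝ)
    (hdec : RowPerturb.IsEigenDecomp hrn.le A lam V₁ V₂)
    (hlam : lam ⟨r, hrn⟩ < lam ⟨r - 1, (Nat.sub_le r 1).trans_lt hrn⟩)
    (hgap : RowPerturb.norm2 E ≤ RowPerturb.gap hrn.le lam V₂ / 5)
    (Vhat : Matrix (Fin n) (Fin r) ℝ) (hVhat : Vhatᵀ * Vhat = 1)
    (hdom : RowPerturb.IsDominantSubspace (r := r) hrn.le (A + E)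
      (LinearMap.range Vhat.mulVecLin)) :
    ∃ d : ℝ,
      IsLeast {x : ℝ | ∃ U ∈ Matrix.orthogonalGroup (Fin r) ℝ,
        x = RowPerturb.norm2Inf (Vhat * U - V₁)} d ∧
      d ≤ 8 * RowPerturb.norm2Inf V₁ *
            (RowPerturb.norm2 (V₂ᵀ * E * V₁) /
              RowPerturb.sep RowPerturb.norm2 (RowPerturb.topDiag hrn.le lam)
                (RowPerturb.botDiag hrn.le lam)) ^ 2
          + 2 * (RowPerturb.norm2Inf (V₂ * (V₂ᵀ * E * V₁)) / RowPerturb.gap hrn.le lam V₂)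
          + 4 * (RowPerturb.norm2Inf (V₂ * (V₂ᵀ * E * V₂) * V₂ᵀ) *
                RowPerturb.norm2 (V₂ᵀ * E * V₁) /
              (RowPerturb.gap hrn.le lam V₂ *
                RowPerturb.sep RowPerturb.norm2 (RowPerturb.topDiag hrn.le lam)
                  (RowPerturb.botDiag hrn.le lam))) := by
  have : NeZero n := ⟨by omega⟩
  obtain ⟨d, hd⟩ := RowPerturb.exists_isLeast_norm2Inf Vhat V₁
  refine ⟨d, hd, ?_⟩
  obtain ⟨mu, W₁, W₂, hdec', hrange⟩ := hdom
  obtain ⟨Q, hQ, hQW⟩ :=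
    RowPerturb.exists_orthogonal_of_range_eq hVhat hdec'.orthonormal₁ hrange
  obtain ⟨U, hU, hle⟩ := hdec.exists_orthogonal_norm2Inf_le_of_gap hdec' hr rfl rfl hlam hgap
  -- `Q * U` carries the alignment of `W₁` over to `Vhat`.
  have hdle : d ≤ RowPerturb.norm2Inf (W₁ * U - V₁) :=
    hd.2 ⟨Q * U, mul_mem hQ hU, by rw [← hQW, Matrix.mul_assoc]⟩
  rw [hdec.sep_eq hr rfl rfl hlam]
  refine (hdle.trans hle).trans ?_
  refine add_le_add (add_le_add (mul_le_mul_of_nonneg_right ?_ (sq_nonneg _)) le_rfl) le_rfl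
  -- The argument gives the constant `4` in the quadratic term, which is weakened to `8`.
  linarith [RowPerturb.norm2Inf_nonneg V₁]
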